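/- Let $-\infty\le -M<N\le\infty$, $E=(-M,N)$, $o\in E$, and let $a,b$ be real measurable functions on $E$ with $a>0$ on $E$ and $b/a$ locally integrable on $E$. Put $$C(x)=\int_o^x \frac{b}{a}\,du,\qquad \mu(dx)=\frac{e^{C(x)}}{a(x)}\,dx,\qquad \nu(dx)=e^{-C(x)}\,dx\qquad\text{on }E,$$ and write $\mu(x,y)=\mu((x,y))$, $\nu(x,y)=\nu((x,y))$. Assume that $\mu(-M,N)<\infty$ (the ergodic case). Let $\mathscr A(-M,N)$ be the set of real functions on $E$ that are absolutely continuous on every compact subinterval of $E$, let $D(f)=\int_{-M}^{N} (f')^2 e^{C}\,dx\in[0,\infty]$ for $f\in\mathscr A(-M,N)$, and define $$\lambda^{\mathrm{NN}}=\inf\Big\{D(f): f\in\mathscr A(-M,N),\ \int_E f\,d\mu=0,\ \int_E f^2\,d\mu=1\Big\},$$ and $\kappa^{\mathrm{NN}}\in[0,\infty]$ by $$\big(\kappa^{\mathrm{NN}}\big)^{-1}=\inf_{x<y,\ x,y\in E}\big[\mu(-M,x)^{-1}+\mu(y,N)^{-1}\big]\,\nu(x,y)^{-1}$$ (with $0^{-1}=\infty$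 and $\infty^{-1}=0$). Then $$\big(4\,\kappa^{\mathrm{NN}}\big)^{-1}\le\lambda^{\mathrm{NN}}\le\big(\kappa^{\mathrm{NN}}\big)^{-1}.$$ -/

import Mathlib

open MeasureTheory Set
open scoped ENNReal

noncomputable section

namespace NeumannGap

/-- The open interval `E = (-M, N)`, where `M, N ≤ ∞` (endpoints may be infinite). -/
def stateInterval (M N : EReal) : Set ℝ :=
  {x : ℝ | -M < (x : EReal) ∧ (x : EReal) < N}

/-- `C(x) = ∫_o^x b/a`. -/
def potential (a b : ℝ → ℝ) (o x : ℝ) : ℝ :=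
  ∫ t in o..x, b t / a t

/-- The measure `μ(dx) = (e^{C(x)} / a(x)) dx` on `(-M, N)`. -/
def speedMeasure (M N : EReal) (a b : ℝ → ℝ) (o : ℝ) : Measure ℝ :=
  (volume.restrict (stateInterval M N)).withDensity
    (fun x => ENNReal.ofReal (Real.exp (potential a b o x) / a x))

/-- The measure `ν(dx) = e^{-C(x)} dx` on `(-M, N)`. -/
def scaleMeasure (M N : EReal) (a b : ℝ → ℝ) (o : ℝ) : Measure ℝ :=
  (volume.restrict (stateInterval M N)).withDensity
    (fun x => ENNReal.ofReal (Real.exp (-potential a b o x)))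

/-- The class `𝒜(-M, N)`: functions absolutely continuous on every compact subinterval
of `(-M, N)`. Values outside `(-M, N)` are irrelevant. -/
def IsAC (M N : EReal) (f : ℝ → ℝ) : Prop :=
  ∀ p ∈ stateInterval M N, ∀ q ∈ stateInterval M N, p ≤ q →
    AbsolutelyContinuousOnInterval f p q

/-- `D(f) = ∫_{-M}^N f'² e^C`, with values in `[0, ∞]`. -/
def energy (M N : EReal) (a b : ℝ → ℝ) (o : ℝ) (f : ℝ → ℝ) : ℝ≥0∞ :=
  ∫⁻ x in stateInterval M N,
    ENNReal.ofReal ((deriv f x) ^ 2 * Real.exp (potential a b o x))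

/-- `λ^NN = inf {D(f) : f ∈ 𝒜(-M, N), μ(f) = 0, ‖f‖ = 1}`, with the norm of `L²(μ)`. -/
def lambdaNN (M N : EReal) (a b : ℝ → ℝ) (o : ℝ) : ℝ≥0∞ :=
  sInf {d : ℝ≥0∞ | ∃ f : ℝ → ℝ, IsAC M N f ∧
    Integrable f (speedMeasure M N a b o) ∧
    ∫ x, f x ∂(speedMeasure M N a b o) = 0 ∧
    eLpNorm f 2 (speedMeasure M N a b o) = 1 ∧
    d = energy M N a b o f}

/-- The constant `κ^NN`, given by
`(κ^NN)⁻¹ = inf_{x < y} [μ(-M, x)⁻¹ + μ(y, N)⁻¹] ν(x, y)⁻¹` with `x, y ∈ (-M, N)`. -/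
def kappaNN (M N : EReal) (a b : ℝ → ℝ) (o : ℝ) : ℝ≥0∞ :=
  (⨅ (x : ℝ) (y : ℝ) (_ : x ∈ stateInterval M N) (_ : y ∈ stateInterval M N) (_ : x < y),
    ((speedMeasure M N a b o {z : ℝ | -M < (z : EReal) ∧ z < x})⁻¹ +
      (speedMeasure M N a b o {z : ℝ | y < z ∧ (z : EReal) < N})⁻¹) *
    (scaleMeasure M N a b o (Ioo x y))⁻¹)⁻¹

end NeumannGap

end

/-! Lower bound. There is a point `θ` in `E` at which both one-sided Muckenhoupt constants are at
most `κ`: `ν(θ,y) μ(y,N) ≤ κ` and `ν(x,θ) μ(-M,x) ≤ κ` for all `y` and `x`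
(`exists_splitting_point`). Muckenhoupt's inequality on each side of `θ`
(`lintegral_sq_setLIntegral_Iic_le` and its mirror image) then gives `∫ (f - f(θ))² dμ ≤ 4κ D(f)`.
For `f` of mean zero and norm one the left side is at least 1 (`one_le_lintegral_ofReal_sq_sub`).

The point `θ` comes from connectedness. The sets of `θ` that are good on the right and good on the
left are closed. They cover `E`: if `θ` failed on both sides, adding the two failures would give a
pair `x < y` with `ν(x,y) > κ (μ(-M,x)⁻¹ + μ(y,N)⁻¹)`, against the definition of `κ`. Both meet `E`,
so they meet each other there.

Upper bound. For `x < y` the test function is the primitive of `e^{-C}` on `(x,y)`, constant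
outside. Its energy is `v = ν(x,y)`. With `p = μ(-M,x)` and `q = μ(y,N)`, its values 0 and `v` on
the two outer pieces already force a centred second moment of at least `v² p q / (p + q)`. -/

/-! ### Powers of a distribution function integrated against its own measure -/

section LinearOrderMeasure

variable {α : Type*} [LinearOrder α] [TopologicalSpace α] [OrderTopology α] [MeasurableSpace α]

/-- A lower set is the increasing union of the segments `Iic x` over its points, so continuity from
below applies. -/
theorem measure_le_of_isLowerSet_of_measure_Iic_le [SecondCountableTopology α] {m : Measure α} {S : Set α}
    (hS : IsLowerSet S) {c : ℝ≥0∞} (h : ∀ x ∈ S, m (Iic x) ≤ c) : m S ≤ c := by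
  have : OrdConnected S := hS.ordConnected
  have hU : S = ⋃ x : S, Iic (x : α) := by
    ext z
    simp only [mem_iUnion, mem_Iic]
    exact ⟨fun hz => ⟨⟨z, hz⟩, le_rfl⟩, fun ⟨x, hx⟩ => hS hx x.2⟩
  have hmono : Monotone fun x : S => Iic (x : α) := fun x y hxy => Iic_subset_Iic.2 hxy
  rw [hU, hmono.measure_iUnion]
  exact iSup_le fun x => h x x.2

theorem measure_setOf_measure_Iic_lt_le [SecondCountableTopology α] (m : Measure α) (c : ℝ≥0∞) :
    m {x | m (Iic x) < c} ≤ c :=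
  measure_le_of_isLowerSet_of_measure_Iic_le
    (fun _ _ hyx hx => (measure_mono (Iic_subset_Iic.2 hyx)).trans_lt hx) fun _ hx => le_of_lt hx

theorem ae_measure_Iic_ne_zero [SecondCountableTopology α] (m : Measure α) : ∀ᵐ x ∂m, m (Iic x) ≠ 0 := by
  rw [ae_iff]
  simp only [ne_eq, not_not]
  refine le_antisymm (measure_le_of_isLowerSet_of_measure_Iic_le ?_ fun x hx => le_of_eq hx) bot_le
  exact fun x y hyx hx => le_antisymm ((measure_mono (Iic_subset_Iic.2 hyx)).trans_eq hx) bot_le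

variable [BorelSpace α]

theorem measurable_measure_Iic (m : Measure α) : Measurable fun x => m (Iic x) :=
  Monotone.measurable fun _ _ h => measure_mono (Iic_subset_Iic.2 h)

theorem measurable_measure_Ici (m : Measure α) : Measurable fun x => m (Ici x) :=
  Antitone.measurable fun _ _ h => measure_mono (Ici_subset_Ici.2 h)

variable [SecondCountableTopology α]

/-- The analogue of `∫ V^{-1/2} dV = 2 V^{1/2}`; atoms are allowed, because only `m {V < c} ≤ c` is
used. By the layer-cake formula the level sets `{V^{-1/2} > t}` have mass at most `min(T, t⁻²)`,
where `T` is the total mass. -/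
theorem lintegral_measure_Iic_rpow_neg_half_le (m : Measure α) :
    ∫⁻ x, m (Iic x) ^ (-(1 / 2) : ℝ) ∂m ≤ 2 * m univ ^ (1 / 2 : ℝ) := by
  rcases eq_or_ne (m univ) ∞ with hT | hT
  · simp [hT]
  rcases eq_or_ne (m univ) 0 with hT0 | hT0
  · simp [Measure.measure_univ_eq_zero.1 hT0]
  have hfin : ∀ x, m (Iic x) ≠ ∞ := fun x => measure_ne_top_of_subset (subset_univ _) hT
  set T := (m univ).toReal with hTdef
  have hTpos : 0 < T := ENNReal.toReal_pos hT0 hT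
  set f : α → ℝ := fun x => (m (Iic x)).toReal ^ (-(1 / 2) : ℝ) with hf
  have hfm : Measurable f := (measurable_measure_Iic m).ennreal_toReal.pow_const _
  -- Where `m (Iic x) = 0` the extended power is `∞` and the real one is 0; such points form a null
  -- set.
  have h1 : ∫⁻ x, m (Iic x) ^ (-(1 / 2) : ℝ) ∂m = ∫⁻ x, ENNReal.ofReal (f x) ∂m := by
    refine lintegral_congr_ae ?_
    filter_upwards [ae_measure_Iic_ne_zero m] with x hx
    rw [hf, ← ENNReal.ofReal_rpow_of_pos (ENNReal.toReal_pos hx (hfin x)),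
      ENNReal.ofReal_toReal (hfin x)]
  rw [h1, lintegral_eq_lintegral_meas_lt m
    (Filter.Eventually.of_forall fun x => Real.rpow_nonneg ENNReal.toReal_nonneg _)
    hfm.aemeasurable]
  have hlev : ∀ t ∈ Ioi (0 : ℝ), m {a | t < f a} ≤ ENNReal.ofReal (t ^ (-2 : ℝ)) := by
    intro t ht
    refine le_trans (measure_mono ?_) (measure_setOf_measure_Iic_lt_le m _)
    intro a ha
    have ha' : t < (m (Iic a)).toReal ^ (-(1 / 2) : ℝ) := ha
    have ht' : (0 : ℝ) < t := ht
    simp only [mem_ofPred_eq]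
    rw [ENNReal.lt_ofReal_iff_toReal_lt (hfin a)]
    rcases (ENNReal.toReal_nonneg (a := m (Iic a))).eq_or_lt with h0 | h0
    · rw [← h0]; positivity
    · have := Real.rpow_lt_rpow_of_neg ht' ha' (show (-2 : ℝ) < 0 by norm_num)
      rwa [← Real.rpow_mul h0.le, show (-(1 / 2) : ℝ) * -2 = 1 by norm_num, Real.rpow_one] at this
  -- The crossover of the two level bounds, where `T = s⁻²`; each side of it contributes at most
  -- `T^{1/2}`.
  set s := T ^ (-(1 / 2) : ℝ) with hs
  have hspos : 0 < s := Real.rpow_pos_of_pos hTpos _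
  have hTs : T * s = T ^ (1 / 2 : ℝ) := by
    rw [hs]; nth_rewrite 1 [← Real.rpow_one T]; rw [← Real.rpow_add hTpos]; norm_num
  rw [← Ioc_union_Ioi_eq_Ioi hspos.le]
  refine (lintegral_union_le _ _ _).trans ?_
  have hA : ∫⁻ t in Ioc 0 s, m {a | t < f a} ≤ ENNReal.ofReal (T ^ (1 / 2 : ℝ)) := by
    calc _ ≤ ∫⁻ t in Ioc 0 s, m univ := lintegral_mono fun t => measure_mono (subset_univ _)
      _ = _ := by
        rw [setLIntegral_const, Real.volume_Ioc, sub_zero, ← ENNReal.ofReal_toReal hT,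
          ← ENNReal.ofReal_mul ENNReal.toReal_nonneg, ← hTdef, hTs]
  have hB : ∫⁻ t in Ioi s, m {a | t < f a} ≤ ENNReal.ofReal (T ^ (1 / 2 : ℝ)) := by
    calc _ ≤ ∫⁻ t in Ioi s, ENNReal.ofReal (t ^ (-2 : ℝ)) :=
          setLIntegral_mono' measurableSet_Ioi fun t ht => hlev t (hspos.trans ht)
      _ = ENNReal.ofReal (∫ t in Ioi s, t ^ (-2 : ℝ)) := by
        rw [ofReal_integral_eq_lintegral_ofReal
          (integrableOn_Ioi_rpow_of_lt (by norm_num) hspos)]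
        exact (ae_restrict_iff' measurableSet_Ioi).2 (Filter.Eventually.of_forall fun t ht =>
          Real.rpow_nonneg (hspos.trans ht).le _)
      _ = _ := by
        rw [integral_Ioi_rpow_of_lt (by norm_num) hspos, hs, ← Real.rpow_mul hTpos.le]
        norm_num
  refine (add_le_add hA hB).trans_eq ?_
  rw [← two_mul, ← ENNReal.ofReal_rpow_of_pos hTpos, ENNReal.ofReal_toReal hT]

theorem setLIntegral_measure_Iic_rpow_neg_half_le (m : Measure α) (y : α) :
    ∫⁻ x in Iic y, m (Iic x) ^ (-(1 / 2) : ℝ) ∂m ≤ 2 * m (Iic y) ^ (1 / 2 : ℝ) := by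
  have h := lintegral_measure_Iic_rpow_neg_half_le (m.restrict (Iic y))
  rw [Measure.restrict_apply_univ] at h
  refine le_trans (setLIntegral_mono' measurableSet_Iic fun x hx => ?_) h
  rw [Measure.restrict_apply measurableSet_Iic, inter_eq_left.2 (Iic_subset_Iic.2 hx)]

theorem setLIntegral_measure_Ici_rpow_neg_half_le (m : Measure α) (y : α) :
    ∫⁻ x in Ici y, m (Ici x) ^ (-(1 / 2) : ℝ) ∂m ≤ 2 * m (Ici y) ^ (1 / 2 : ℝ) :=
  setLIntegral_measure_Iic_rpow_neg_half_le (α := αᵒᵈ) m y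

end LinearOrderMeasure

/-! ### Muckenhoupt's weighted Hardy inequality -/

section Hardy

variable {α : Type*} [LinearOrder α] [TopologicalSpace α] [OrderTopology α]
  [SecondCountableTopology α] [MeasurableSpace α] [BorelSpace α]

theorem lintegral_mul_setLIntegral_Iic (μ ν : Measure α) [SFinite μ] [SFinite ν]
    {u w : α → ℝ≥0∞} (hu : Measurable u) (hw : AEMeasurable w ν) :
    ∫⁻ y, u y * ∫⁻ t in Iic y, w t ∂ν ∂μ = ∫⁻ t, w t * ∫⁻ y in Ici t, u y ∂μ ∂ν := by
  have hS : MeasurableSet {p : α × α | p.2 ≤ p.1} := measurableSet_le measurable_snd measurable_fst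
  have h1 : ∀ y, u y * ∫⁻ t in Iic y, w t ∂ν =
      ∫⁻ t, {p : α × α | p.2 ≤ p.1}.indicator (fun p => u p.1 * w p.2) (y, t) ∂ν := by
    intro y
    rw [← lintegral_const_mul'' _ hw.restrict, ← lintegral_indicator measurableSet_Iic]
    rfl
  have h2 : ∀ t, w t * ∫⁻ y in Ici t, u y ∂μ =
      ∫⁻ y, {p : α × α | p.2 ≤ p.1}.indicator (fun p => u p.1 * w p.2) (y, t) ∂μ := by
    intro t
    rw [mul_comm, ← lintegral_mul_const _ hu, ← lintegral_indicator measurableSet_Ici]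
    rfl
  simp_rw [h1, h2]
  refine lintegral_lintegral_swap (f := fun y t =>
    {p : α × α | p.2 ≤ p.1}.indicator (fun p => u p.1 * w p.2) (y, t)) ?_
  exact ((hu.comp measurable_fst).aemeasurable.mul hw.comp_snd).indicator hS

/-- Cauchy–Schwarz for `g = (g V^{1/4}) · V^{-1/4}` with `V t = ν (Iic t)`; the second factor is
controlled by the `V^{-1/2}` integral. -/
theorem sq_setLIntegral_Iic_le (ν : Measure α) (hν : ∀ᵐ t ∂ν, ν (Iic t) ≠ ∞)
    {g : α → ℝ≥0∞} (hg : AEMeasurable g ν) (y : α) :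
    (∫⁻ t in Iic y, g t ∂ν) ^ 2 ≤
      2 * ν (Iic y) ^ (1 / 2 : ℝ) * ∫⁻ t in Iic y, g t ^ 2 * ν (Iic t) ^ (1 / 2 : ℝ) ∂ν := by
  have hV := measurable_measure_Iic ν
  have h1 : ∫⁻ t in Iic y, g t ∂ν = ∫⁻ t in Iic y,
      ((fun t => g t * ν (Iic t) ^ (1 / 4 : ℝ)) * fun t => ν (Iic t) ^ (-(1 / 4) : ℝ)) t ∂ν := by
    refine lintegral_congr_ae (ae_restrict_of_ae ?_)
    filter_upwards [hν, ae_measure_Iic_ne_zero ν] with t ht ht0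
    rw [Pi.mul_apply, mul_assoc, ← ENNReal.rpow_add _ _ ht0 ht]
    norm_num
  have h2 := ENNReal.lintegral_mul_le_Lp_mul_Lq (ν.restrict (Iic y)) Real.HolderConjugate.two_two
    (f := fun t => g t * ν (Iic t) ^ (1 / 4 : ℝ)) (g := fun t => ν (Iic t) ^ (-(1 / 4) : ℝ))
    (hg.restrict.mul (hV.pow_const _).aemeasurable) (hV.pow_const _).aemeasurable
  rw [← h1] at h2
  have h3 : ∀ t, (g t * ν (Iic t) ^ (1 / 4 : ℝ)) ^ (2 : ℝ) =
      g t ^ 2 * ν (Iic t) ^ (1 / 2 : ℝ) := by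
    intro t
    rw [ENNReal.mul_rpow_of_nonneg _ _ (by norm_num), ← ENNReal.rpow_mul, ENNReal.rpow_two]
    norm_num
  have h4 : ∀ t, (ν (Iic t) ^ (-(1 / 4) : ℝ)) ^ (2 : ℝ) = ν (Iic t) ^ (-(1 / 2) : ℝ) := by
    intro t
    rw [← ENNReal.rpow_mul]
    norm_num
  simp only [h3, h4] at h2
  have hsq : ∀ x : ℝ≥0∞, (x ^ (1 / 2 : ℝ)) ^ 2 = x := by
    intro x
    rw [← ENNReal.rpow_two, ← ENNReal.rpow_mul]
    norm_num
  calc (∫⁻ t in Iic y, g t ∂ν) ^ 2 ≤ _ := pow_le_pow_left' h2 2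
    _ = (∫⁻ t in Iic y, ν (Iic t) ^ (-(1 / 2) : ℝ) ∂ν) *
        ∫⁻ t in Iic y, g t ^ 2 * ν (Iic t) ^ (1 / 2 : ℝ) ∂ν := by
      rw [mul_pow, hsq, hsq, mul_comm]
    _ ≤ _ := by gcongr; exact setLIntegral_measure_Iic_rpow_neg_half_le ν y

/-- **Muckenhoupt's weighted Hardy inequality** with constant `4`. -/
theorem lintegral_sq_setLIntegral_Iic_le (μ ν : Measure α) [IsFiniteMeasure μ] [SFinite ν]
    {B : ℝ≥0∞} (hB0 : B ≠ 0) (hB : ∀ y, ν (Iic y) * μ (Ici y) ≤ B)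
    (hν : ∀ᵐ t ∂ν, ν (Iic t) ≠ ∞) {g : α → ℝ≥0∞} (hg : AEMeasurable g ν) :
    ∫⁻ y, (∫⁻ t in Iic y, g t ∂ν) ^ 2 ∂μ ≤ 4 * B * ∫⁻ t, g t ^ 2 ∂ν := by
  have hV := measurable_measure_Iic ν
  have hU := measurable_measure_Ici μ
  -- The hypothesis `hB` trades the growth of `ν` for the decay of the tail of `μ`. Since `B ≠ 0`,
  -- the bound is `∞` where the tail vanishes.
  have hVU : ∀ y, ν (Iic y) ^ (1 / 2 : ℝ) ≤ B ^ (1 / 2 : ℝ) * μ (Ici y) ^ (-(1 / 2) : ℝ) := by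
    intro y
    have h : ν (Iic y) ≤ B / μ (Ici y) :=
      (ENNReal.le_div_iff_mul_le (Or.inr hB0) (Or.inl (measure_ne_top _ _))).2 (hB y)
    refine (ENNReal.rpow_le_rpow h (by norm_num)).trans_eq ?_
    rw [ENNReal.div_rpow_of_nonneg _ _ (by norm_num), ENNReal.rpow_neg, div_eq_mul_inv]
  have hw : AEMeasurable (fun t => g t ^ 2 * ν (Iic t) ^ (1 / 2 : ℝ)) ν :=
    (hg.pow_const 2).mul (hV.pow_const _).aemeasurable
  calc ∫⁻ y, (∫⁻ t in Iic y, g t ∂ν) ^ 2 ∂μ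
      ≤ ∫⁻ y, 2 * B ^ (1 / 2 : ℝ) * (μ (Ici y) ^ (-(1 / 2) : ℝ) *
          ∫⁻ t in Iic y, g t ^ 2 * ν (Iic t) ^ (1 / 2 : ℝ) ∂ν) ∂μ := by
        refine lintegral_mono fun y => (sq_setLIntegral_Iic_le ν hν hg y).trans ?_
        rw [← mul_assoc, mul_assoc 2 (B ^ (1 / 2 : ℝ))]
        exact mul_le_mul_left (mul_le_mul_right (hVU y) 2) _
    _ ≤ 2 * B ^ (1 / 2 : ℝ) * ∫⁻ y, μ (Ici y) ^ (-(1 / 2) : ℝ) *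
          ∫⁻ t in Iic y, g t ^ 2 * ν (Iic t) ^ (1 / 2 : ℝ) ∂ν ∂μ := by
        refine (lintegral_const_mul _ ((hU.pow_const _).mul ?_)).le
        exact Monotone.measurable fun a b hab => lintegral_mono_set (Iic_subset_Iic.2 hab)
    _ = 2 * B ^ (1 / 2 : ℝ) * ∫⁻ t, g t ^ 2 * ν (Iic t) ^ (1 / 2 : ℝ) *
          ∫⁻ y in Ici t, μ (Ici y) ^ (-(1 / 2) : ℝ) ∂μ ∂ν := by
        rw [lintegral_mul_setLIntegral_Iic μ ν (hU.pow_const _) hw]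
    _ ≤ 2 * B ^ (1 / 2 : ℝ) * ∫⁻ t, (2 * B ^ (1 / 2 : ℝ)) * g t ^ 2 ∂ν := by
        -- After Tonelli the same power estimate is applied to the tails of `μ`, and `hB` absorbs
        -- the product of the two square roots; each use of the estimate contributes a factor 2.
        refine mul_le_mul_right (lintegral_mono fun t => ?_) _
        calc g t ^ 2 * ν (Iic t) ^ (1 / 2 : ℝ) * ∫⁻ y in Ici t, μ (Ici y) ^ (-(1 / 2) : ℝ) ∂μ
            ≤ g t ^ 2 * ν (Iic t) ^ (1 / 2 : ℝ) * (2 * μ (Ici t) ^ (1 / 2 : ℝ)) := by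
              gcongr; exact setLIntegral_measure_Ici_rpow_neg_half_le μ t
          _ = 2 * (ν (Iic t) * μ (Ici t)) ^ (1 / 2 : ℝ) * g t ^ 2 := by
              rw [ENNReal.mul_rpow_of_nonneg _ _ (by norm_num)]; ring
          _ ≤ _ := by gcongr; exact hB t
    _ = 4 * (B ^ (1 / 2 : ℝ) * B ^ (1 / 2 : ℝ)) * ∫⁻ t, g t ^ 2 ∂ν := by
        rw [lintegral_const_mul'' _ (hg.pow_const 2)]; ring
    _ = _ := by
        rw [← ENNReal.rpow_add_of_nonneg _ _ (by norm_num) (by norm_num)]; norm_num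

theorem lintegral_sq_setLIntegral_Ici_le (μ ν : Measure α) [IsFiniteMeasure μ] [SFinite ν]
    {B : ℝ≥0∞} (hB0 : B ≠ 0) (hB : ∀ y, ν (Ici y) * μ (Iic y) ≤ B)
    (hν : ∀ᵐ t ∂ν, ν (Ici t) ≠ ∞) {g : α → ℝ≥0∞} (hg : AEMeasurable g ν) :
    ∫⁻ y, (∫⁻ t in Ici y, g t ∂ν) ^ 2 ∂μ ≤ 4 * B * ∫⁻ t, g t ^ 2 ∂ν :=
  have : IsFiniteMeasure (α := αᵒᵈ) μ := ‹IsFiniteMeasure μ›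
  have : SFinite (α := αᵒᵈ) ν := ‹SFinite ν›
  lintegral_sq_setLIntegral_Iic_le (α := αᵒᵈ) μ ν hB0 hB hν hg

end Hardy

/-! ### The splitting point -/

section SplittingPoint

variable {α : Type*} [LinearOrder α] [TopologicalSpace α] [OrderTopology α]
  [SecondCountableTopology α] [MeasurableSpace α]

/-- The map `θ ↦ m (Ioi θ)` is antitone and continuous from the right, so a strict lower bound at
`θ` persists at some `v n > θ`, hence at every point below `v n`. -/
theorem isClosed_setOf_measure_Ioi_mul_le [DenselyOrdered α] [NoMaxOrder α]
    (m : Measure α) (u c : ℝ≥0∞) : IsClosed {θ | m (Ioi θ) * u ≤ c} := by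
  refine isOpen_compl_iff.1 (isOpen_iff_mem_nhds.2 fun θ hθ => ?_)
  have hθ' : c < m (Ioi θ) * u := lt_of_not_ge hθ
  obtain ⟨v, -, hv, hvt⟩ := exists_seq_strictAnti_tendsto' (exists_gt θ).choose_spec
  have hU : Ioi θ = ⋃ n, Ioi (v n) := by
    ext z
    simp only [mem_iUnion, mem_Ioi]
    refine ⟨fun hz => ?_, fun ⟨n, hn⟩ => (hv n).1.trans hn⟩
    exact (hvt.eventually (gt_mem_nhds hz)).exists
  have hd : Directed (· ⊆ ·) fun n => Ioi (v n) := by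
    intro i j
    rcases le_total (v i) (v j) with h | h
    · exact ⟨i, subset_rfl, Ioi_subset_Ioi h⟩
    · exact ⟨j, Ioi_subset_Ioi h, subset_rfl⟩
  rw [hU, hd.measure_iUnion, ENNReal.iSup_mul] at hθ'
  obtain ⟨n, hn⟩ := lt_iSup_iff.1 hθ'
  filter_upwards [gt_mem_nhds (hv n).1] with z hz hz'
  exact absurd (hn.trans_le (by gcongr)) (not_lt_of_ge hz')

/-- For `o ≤ θ < y` the product is at most `ν (Ioi o) * μ (Ioi θ)`, which tends to 0 as `θ`
approaches the right end of `E`. -/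
theorem exists_forall_measure_Ioo_mul_le [BorelSpace α] {E : Set α} [E.OrdConnected]
    {μ ν : Measure α} [IsFiniteMeasure μ] (hμE : μ Eᶜ = 0) {o : α} (ho : o ∈ E)
    (hν : ν (Ioi o) ≠ ∞) {κ : ℝ≥0∞} (hκ : κ ≠ 0) :
    ∃ θ ∈ E, ∀ y, ν (Ioo θ y) * μ (Ioi y) ≤ κ := by
  have : Nonempty E := ⟨⟨o, ho⟩⟩
  have h1 : Filter.Tendsto (fun θ : E => μ (Ioi (θ : α))) Filter.atTop
      (nhds (μ (⋂ θ : E, Ioi (θ : α)))) :=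
    tendsto_measure_iInter_atTop (fun _ => measurableSet_Ioi.nullMeasurableSet)
      (fun _ _ h => Ioi_subset_Ioi h) ⟨⟨o, ho⟩, measure_ne_top _ _⟩
  have h0 : μ (⋂ θ : E, Ioi (θ : α)) = 0 :=
    measure_mono_null (fun z hz hzE => lt_irrefl z (mem_iInter.1 hz ⟨z, hzE⟩)) hμE
  rw [h0] at h1
  have h2 := ENNReal.Tendsto.const_mul (a := ν (Ioi o)) h1 (Or.inr hν)
  rw [mul_zero] at h2
  obtain ⟨θ, hθ, hoθ⟩ := ((h2.eventually (gt_mem_nhds (pos_iff_ne_zero.2 hκ))).and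
    (Filter.eventually_ge_atTop ⟨o, ho⟩)).exists
  refine ⟨θ, θ.2, fun y => ?_⟩
  rcases le_or_gt y θ with hy | hy
  · simp [Ioo_eq_empty_of_le hy]
  · refine le_trans (mul_le_mul' (measure_mono ?_) (measure_mono (Ioi_subset_Ioi hy.le))) hθ.le
    exact fun z hz => lt_of_le_of_lt hoθ hz.1

theorem measure_Ioi_ne_top_of_forall_measure_Ioo_mul_le {E : Set α} [E.OrdConnected]
    (hE : ∀ z ∈ E, ∃ θ ∈ E, z < θ) {ν : Measure α} (hνE : ν Eᶜ = 0) {o : α}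
    {κ u : ℝ≥0∞} (hκ : κ ≠ ∞) (hu : u ≠ 0) (h : ∀ θ ∈ E, ν (Ioo o θ) * u ≤ κ) :
    ν (Ioi o) ≠ ∞ := by
  have h1 : ν (Ioi o) ≤ ν (⋃ θ : E, Ioo o (θ : α)) := by
    refine (measure_le_inter_add_sdiff ν (Ioi o) E).trans ?_
    rw [measure_mono_null (sdiff_subset_compl (Ioi o) E) hνE, add_zero]
    refine measure_mono fun z hz => ?_
    obtain ⟨θ, hθ, hzθ⟩ := hE z hz.2
    exact mem_iUnion.2 ⟨⟨θ, hθ⟩, hz.1, hzθ⟩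
  have hm : Monotone fun θ : E => Ioo o (θ : α) := fun _ _ h => Ioo_subset_Ioo_right h
  rw [hm.measure_iUnion] at h1
  refine ne_top_of_le_ne_top (ENNReal.div_ne_top hκ hu) (h1.trans (iSup_le fun θ => ?_))
  exact (ENNReal.le_div_iff_mul_le (Or.inl hu) (Or.inr hκ)).2 (h θ θ.2)

end SplittingPoint

theorem exists_splitting_point {E : Set ℝ} (hEo : IsOpen E) (hEc : E.OrdConnected)
    (hEn : E.Nonempty) {μ ν : Measure ℝ} [IsFiniteMeasure μ] (hμE : μ Eᶜ = 0) (hνE : ν Eᶜ = 0)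
    {κ : ℝ≥0∞} (hκ0 : κ ≠ 0) (hκt : κ ≠ ∞) (hl : ∀ x ∈ E, μ (Iio x) ≠ 0)
    (hr : ∀ x ∈ E, μ (Ioi x) ≠ 0)
    (hκ : ∀ x ∈ E, ∀ y ∈ E, x < y →
      ν (Ioo x y) ≤ κ * ((μ (Iio x))⁻¹ + (μ (Ioi y))⁻¹)) :
    ∃ θ ∈ E, (∀ y, ν (Ioo θ y) * μ (Ioi y) ≤ κ) ∧ ∀ x, ν (Ioo x θ) * μ (Iio x) ≤ κ := by
  obtain ⟨o, ho⟩ := hEn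
  set A : Set ℝ := {θ | ∀ y, ν (Ioo θ y) * μ (Ioi y) ≤ κ} with hA
  set A' : Set ℝ := {θ | ∀ x, ν (Ioo x θ) * μ (Iio x) ≤ κ} with hA'
  have hAc : IsClosed A := by
    rw [hA, ofPred_forall]
    refine isClosed_iInter fun y => ?_
    have h := isClosed_setOf_measure_Ioi_mul_le (ν.restrict (Iio y)) (μ (Ioi y)) κ
    simpa only [Measure.restrict_apply measurableSet_Ioi, Ioi_inter_Iio] using h
  have hAc' : IsClosed A' := by
    rw [hA', ofPred_forall]
    refine isClosed_iInter fun x => ?_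
    have h : IsClosed {θ | (ν.restrict (Ioi x)) (Iio θ) * μ (Iio x) ≤ κ} :=
      isClosed_setOf_measure_Ioi_mul_le (α := ℝᵒᵈ) (ν.restrict (Ioi x)) (μ (Iio x)) κ
    simpa only [Measure.restrict_apply measurableSet_Iio, Iio_inter_Ioi] using h
  have hcov : E ⊆ A ∪ A' := by
    intro θ hθ
    by_contra hc
    simp only [hA, hA', mem_union, mem_ofPred_eq, not_or, not_forall, not_le] at hc
    obtain ⟨⟨y, hy⟩, x, hx⟩ := hc
    have hθy : θ < y := by
      by_contra h
      simp [Ioo_eq_empty_of_le (not_lt.1 h)] at hy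
    have hxθ : x < θ := by
      by_contra h
      simp [Ioo_eq_empty_of_le (not_lt.1 h)] at hx
    have hyE : y ∈ E := by
      by_contra h
      have : μ (Ioi y) = 0 := measure_mono_null
        (fun z hz hzE => h (hEc.out hθ hzE ⟨hθy.le, le_of_lt hz⟩)) hμE
      simp [this] at hy
    have hxE : x ∈ E := by
      by_contra h
      have : μ (Iio x) = 0 := measure_mono_null
        (fun z hz hzE => h (hEc.out hzE hθ ⟨le_of_lt hz, hxθ.le⟩)) hμE
      simp [this] at hx
    have h1 : κ * (μ (Iio x))⁻¹ < ν (Ioo x θ) :=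
      (ENNReal.div_lt_iff (Or.inl (hl x hxE)) (Or.inl (measure_ne_top _ _))).2 hx
    have h2 : κ * (μ (Ioi y))⁻¹ < ν (Ioo θ y) :=
      (ENNReal.div_lt_iff (Or.inl (hr y hyE)) (Or.inl (measure_ne_top _ _))).2 hy
    have h3 : ν (Ioo x θ) + ν (Ioo θ y) ≤ ν (Ioo x y) := by
      rw [← measure_union _ measurableSet_Ioo]
      · exact measure_mono (union_subset (Ioo_subset_Ioo_right hθy.le)
          (Ioo_subset_Ioo_left hxθ.le))
      · exact disjoint_left.2 fun z hz hz' => lt_asymm hz.2 hz'.1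
    have h4 := ENNReal.add_lt_add h1 h2
    rw [← mul_add] at h4
    exact absurd (h4.trans_le h3) (not_lt_of_ge (hκ x hxE y hyE (hxθ.trans hθy)))
  have hup : ∀ z ∈ E, ∃ θ ∈ E, z < θ := fun z hz => by
    obtain ⟨θ, hzθ, hθ⟩ := (Filter.Eventually.and
      (self_mem_nhdsWithin : ∀ᶠ θ in nhdsWithin z (Ioi z), θ ∈ Ioi z)
      (nhdsWithin_le_nhds (hEo.mem_nhds hz))).exists
    exact ⟨θ, hθ, hzθ⟩
  have hdown : ∀ z ∈ E, ∃ θ ∈ E, θ < z := fun z hz => by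
    obtain ⟨θ, hzθ, hθ⟩ := (Filter.Eventually.and
      (self_mem_nhdsWithin : ∀ᶠ θ in nhdsWithin z (Iio z), θ ∈ Iio z)
      (nhdsWithin_le_nhds (hEo.mem_nhds hz))).exists
    exact ⟨θ, hθ, hzθ⟩
  -- If no point of `E` were good on the right, all would be good on the left. Taking `x = o` there
  -- bounds `ν (Ioo o θ)` uniformly, so `ν (Ioi o)` is finite, and then points near the right end
  -- are good on the right.
  have hne : (E ∩ A).Nonempty := by
    by_contra hemp
    have hsub : ∀ θ ∈ E, θ ∈ A' := fun θ hθ =>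
      (hcov hθ).resolve_left fun h => hemp ⟨θ, hθ, h⟩
    have hfin := measure_Ioi_ne_top_of_forall_measure_Ioo_mul_le hup hνE hκt (hl o ho)
      fun θ hθ => hsub θ hθ o
    obtain ⟨θ, hθ, h⟩ := exists_forall_measure_Ioo_mul_le hμE ho hfin hκ0
    exact hemp ⟨θ, hθ, h⟩
  have hne' : (E ∩ A').Nonempty := by
    by_contra hemp
    have hsub : ∀ θ ∈ E, θ ∈ A := fun θ hθ =>
      (hcov hθ).resolve_right fun h => hemp ⟨θ, hθ, h⟩
    have hEd : OrdConnected (α := ℝᵒᵈ) E := hEc.dual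
    have hμd : IsFiniteMeasure (α := ℝᵒᵈ) μ := ‹IsFiniteMeasure μ›
    have hflip : ∀ (m : Measure ℝ) (p q : ℝ), m (Ioo (α := ℝᵒᵈ) p q) = m (Ioo q p) := by
      intro m p q
      congr 1
      ext z
      exact and_comm
    have hfin : ν (Iio o) ≠ ∞ :=
      measure_Ioi_ne_top_of_forall_measure_Ioo_mul_le (α := ℝᵒᵈ) (E := E) hdown hνE hκt (hr o ho)
        fun θ hθ => (hflip ν o θ).symm ▸ hsub θ hθ o
    obtain ⟨θ, hθ, h⟩ := exists_forall_measure_Ioo_mul_le (α := ℝᵒᵈ) (E := E) (μ := μ) (ν := ν)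
      hμE ho hfin hκ0
    exact hemp ⟨θ, hθ, fun x => (hflip ν θ x) ▸ h x⟩
  obtain ⟨θ, hθ, h, h'⟩ := isPreconnected_closed_iff.1 hEc.isPreconnected A A' hAc hAc' hcov hne hne'
  exact ⟨θ, hθ, h, h'⟩

/-! ### Second moments about an arbitrary constant -/

theorem lintegral_ofReal_sq_eq_eLpNorm_two_sq {α : Type*} [MeasurableSpace α] (μ : Measure α)
    (f : α → ℝ) : ∫⁻ x, ENNReal.ofReal (f x ^ 2) ∂μ = eLpNorm f 2 μ ^ 2 := by
  have h := eLpNorm_nnreal_pow_eq_lintegral (μ := μ) (f := f) (p := 2) (by norm_num)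
  simp only [NNReal.coe_ofNat, ENNReal.rpow_ofNat, ENNReal.coe_ofNat] at h
  rw [h]
  refine lintegral_congr fun x => ?_
  rw [← sq_abs, ENNReal.ofReal_pow (abs_nonneg _), ← Real.enorm_eq_ofReal_abs]

/-- The cross term vanishes at mean zero, leaving `∫ (f - c)² dμ = 1 + c² μ(univ)`. -/
theorem one_le_lintegral_ofReal_sq_sub {α : Type*} [MeasurableSpace α] {μ : Measure α}
    [IsFiniteMeasure μ] {f : α → ℝ} (hf : Integrable f μ) (hf0 : ∫ x, f x ∂μ = 0)
    (hf1 : eLpNorm f 2 μ = 1) (c : ℝ) : 1 ≤ ∫⁻ x, ENNReal.ofReal ((f x - c) ^ 2) ∂μ := by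
  have h2 : MemLp f 2 μ := ⟨hf.aestronglyMeasurable, by simp [hf1]⟩
  have hsq : Integrable (fun x => f x ^ 2) μ := h2.integrable_sq
  have hI : ∫ x, f x ^ 2 ∂μ = 1 := by
    rw [integral_eq_lintegral_of_nonneg_ae (Filter.Eventually.of_forall fun x => sq_nonneg _)
      hsq.aestronglyMeasurable, lintegral_ofReal_sq_eq_eLpNorm_two_sq, hf1]
    simp
  have hexp : ∀ x, (f x - c) ^ 2 = f x ^ 2 - 2 * c * f x + c ^ 2 := fun x => by ring
  have hint : Integrable (fun x => f x ^ 2 - 2 * c * f x) μ := hsq.sub (hf.const_mul _)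
  have hval : ∫ x, (f x - c) ^ 2 ∂μ = 1 + μ.real univ * c ^ 2 := by
    simp_rw [hexp]
    rw [integral_add hint (integrable_const _), integral_sub hsq (hf.const_mul _),
      integral_const_mul, hI, hf0, integral_const, smul_eq_mul]
    ring
  rw [← ofReal_integral_eq_lintegral_ofReal _ (Filter.Eventually.of_forall fun x => sq_nonneg _),
    hval, ENNReal.one_le_ofReal]
  · nlinarith [mul_nonneg (measureReal_nonneg (μ := μ) (s := univ)) (sq_nonneg c)]
  · simp_rw [hexp]
    exact hint.add (integrable_const _)

/-! ### The potential and the measures `μ` and `ν` on `E` -/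

namespace NeumannGap

variable {M N : EReal} {a b : ℝ → ℝ} {o : ℝ}

theorem isOpen_stateInterval (M N : EReal) : IsOpen (stateInterval M N) :=
  (isOpen_lt continuous_const continuous_coe_real_ereal).inter
    (isOpen_lt continuous_coe_real_ereal continuous_const)

theorem measurableSet_stateInterval (M N : EReal) : MeasurableSet (stateInterval M N) :=
  (isOpen_stateInterval M N).measurableSet

theorem ordConnected_stateInterval (M N : EReal) : (stateInterval M N).OrdConnected :=
  ⟨fun _ hp _ hq _ hz => ⟨hp.1.trans_le (EReal.coe_le_coe_iff.2 hz.1),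
    (EReal.coe_le_coe_iff.2 hz.2).trans_lt hq.2⟩⟩

theorem exists_mem_stateInterval_gt {x : ℝ} (hx : x ∈ stateInterval M N) :
    ∃ y ∈ stateInterval M N, x < y := by
  obtain ⟨y, hxy, hy⟩ := (Filter.Eventually.and
    (self_mem_nhdsWithin : ∀ᶠ y in nhdsWithin x (Ioi x), y ∈ Ioi x)
    (nhdsWithin_le_nhds ((isOpen_stateInterval M N).mem_nhds hx))).exists
  exact ⟨y, hy, hxy⟩

theorem exists_mem_stateInterval_lt {x : ℝ} (hx : x ∈ stateInterval M N) :
    ∃ y ∈ stateInterval M N, y < x := by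
  obtain ⟨y, hxy, hy⟩ := (Filter.Eventually.and
    (self_mem_nhdsWithin : ∀ᶠ y in nhdsWithin x (Iio x), y ∈ Iio x)
    (nhdsWithin_le_nhds ((isOpen_stateInterval M N).mem_nhds hx))).exists
  exact ⟨y, hy, hxy⟩

theorem continuousOn_potential (ho : o ∈ stateInterval M N)
    (hba : LocallyIntegrableOn (fun x => b x / a x) (stateInterval M N) volume) :
    ContinuousOn (potential a b o) (stateInterval M N) := by
  intro x hx
  obtain ⟨p, hp, hpx⟩ := exists_mem_stateInterval_lt hx
  obtain ⟨q, hq, hqx⟩ := exists_mem_stateInterval_gt hx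
  -- The interval around `x` is enlarged to contain the base point `o` of the primitive.
  have hp' : min p o ∈ stateInterval M N := by rcases min_choice p o with h | h <;> rwa [h]
  have hq' : max q o ∈ stateInterval M N := by rcases max_choice q o with h | h <;> rwa [h]
  have hle : min p o ≤ max q o := (min_le_right _ _).trans (le_max_right _ _)
  have hint : IntervalIntegrable (fun x => b x / a x) volume (min p o) (max q o) := by
    rw [intervalIntegrable_iff_integrableOn_Icc_of_le hle]
    exact hba.integrableOn_compact_subset ((ordConnected_stateInterval M N).out hp' hq')
      isCompact_Icc
  have h := intervalIntegral.continuousOn_primitive_interval' hint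
    (a := o) (by rw [uIcc_of_le hle]; exact ⟨min_le_right _ _, le_max_right _ _⟩)
  rw [uIcc_of_le hle] at h
  exact (h.continuousAt (Icc_mem_nhds ((min_le_left _ _).trans_lt hpx)
    (hqx.trans_le (le_max_left _ _)))).continuousWithinAt

theorem aemeasurable_exp_potential (hC : ContinuousOn (potential a b o) (stateInterval M N)) :
    AEMeasurable (fun x => Real.exp (potential a b o x)) (volume.restrict (stateInterval M N)) :=
  (hC.aemeasurable (measurableSet_stateInterval M N)).exp

theorem aemeasurable_exp_neg_potential
    (hC : ContinuousOn (potential a b o) (stateInterval M N)) :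
    AEMeasurable (fun x => Real.exp (-potential a b o x)) (volume.restrict (stateInterval M N)) :=
  (hC.aemeasurable (measurableSet_stateInterval M N)).neg.exp

theorem speedMeasure_compl (M N : EReal) (a b : ℝ → ℝ) (o : ℝ) :
    speedMeasure M N a b o (stateInterval M N)ᶜ = 0 :=
  withDensity_absolutelyContinuous _ _ (by
    rw [Measure.restrict_apply (measurableSet_stateInterval M N).compl]; simp)

theorem scaleMeasure_compl (M N : EReal) (a b : ℝ → ℝ) (o : ℝ) :
    scaleMeasure M N a b o (stateInterval M N)ᶜ = 0 :=
  withDensity_absolutelyContinuous _ _ (by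
    rw [Measure.restrict_apply (measurableSet_stateInterval M N).compl]; simp)

instance : NullSingletonClass (speedMeasure M N a b o) := by unfold speedMeasure; infer_instance

instance : NullSingletonClass (scaleMeasure M N a b o) := by unfold scaleMeasure; infer_instance

instance : SFinite (scaleMeasure M N a b o) := by unfold scaleMeasure; infer_instance

theorem isFiniteMeasure_speedMeasure
    (hμ : speedMeasure M N a b o (stateInterval M N) < ∞) :
    IsFiniteMeasure (speedMeasure M N a b o) := by
  refine ⟨?_⟩
  rw [← union_compl_self (stateInterval M N)]
  refine (measure_union_le _ _).trans_lt ?_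
  rwa [speedMeasure_compl, add_zero]

theorem speedMeasure_lower (x : ℝ) :
    speedMeasure M N a b o {z : ℝ | -M < (z : EReal) ∧ z < x} =
      speedMeasure M N a b o (Iio x) := by
  refine le_antisymm (measure_mono fun z hz => hz.2) ?_
  refine (measure_mono (t := {z : ℝ | -M < (z : EReal) ∧ z < x} ∪ (stateInterval M N)ᶜ) fun z hz => ?_).trans
    ((measure_union_le _ _).trans_eq (by rw [speedMeasure_compl, add_zero]))
  by_cases hzE : z ∈ stateInterval M N
  · exact Or.inl ⟨hzE.1, hz⟩
  · exact Or.inr hzE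

theorem speedMeasure_upper (x : ℝ) :
    speedMeasure M N a b o {z : ℝ | x < z ∧ (z : EReal) < N} =
      speedMeasure M N a b o (Ioi x) := by
  refine le_antisymm (measure_mono fun z hz => hz.1) ?_
  refine (measure_mono (t := {z : ℝ | x < z ∧ (z : EReal) < N} ∪ (stateInterval M N)ᶜ) fun z hz => ?_).trans
    ((measure_union_le _ _).trans_eq (by rw [speedMeasure_compl, add_zero]))
  by_cases hzE : z ∈ stateInterval M N
  · exact Or.inl ⟨hz, hzE.2⟩
  · exact Or.inr hzE

theorem speedMeasure_Ioo_ne_zero (hC : ContinuousOn (potential a b o) (stateInterval M N))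
    (ha_pos : ∀ x ∈ stateInterval M N, 0 < a x)
    (ha_meas : AEMeasurable a (volume.restrict (stateInterval M N)))
    {x y : ℝ} (hx : x ∈ stateInterval M N) (hy : y ∈ stateInterval M N) (hxy : x < y) :
    speedMeasure M N a b o (Ioo x y) ≠ 0 := by
  intro h
  have hsub : Ioo x y ⊆ stateInterval M N :=
    Ioo_subset_Icc_self.trans ((ordConnected_stateInterval M N).out hx hy)
  rw [speedMeasure, withDensity_apply _ measurableSet_Ioo,
    Measure.restrict_restrict measurableSet_Ioo, inter_eq_left.2 hsub] at h
  replace h := (lintegral_eq_zero_iff' (((aemeasurable_exp_potential hC).div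
    ha_meas).ennreal_ofReal.mono_measure (Measure.restrict_mono_set _ hsub))).1 h
  have h2 : ∀ᵐ z ∂volume.restrict (Ioo x y), False := by
    filter_upwards [h, ae_restrict_mem measurableSet_Ioo] with z hz hzm
    rw [Pi.zero_apply, ENNReal.ofReal_eq_zero, Pi.div_apply] at hz
    exact absurd hz (not_le_of_gt (div_pos (Real.exp_pos _) (ha_pos z (hsub hzm))))
  rw [ae_iff] at h2
  simp only [not_false_eq_true] at h2
  exact absurd h2 (by simp [hxy])

theorem speedMeasure_Iio_ne_zero (hC : ContinuousOn (potential a b o) (stateInterval M N))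
    (ha_pos : ∀ x ∈ stateInterval M N, 0 < a x)
    (ha_meas : AEMeasurable a (volume.restrict (stateInterval M N)))
    {x : ℝ} (hx : x ∈ stateInterval M N) : speedMeasure M N a b o (Iio x) ≠ 0 := by
  obtain ⟨y, hy, hyx⟩ := exists_mem_stateInterval_lt hx
  exact fun h => speedMeasure_Ioo_ne_zero hC ha_pos ha_meas hy hx hyx
    (measure_mono_null (fun z hz => hz.2) h)

theorem speedMeasure_Ioi_ne_zero (hC : ContinuousOn (potential a b o) (stateInterval M N))
    (ha_pos : ∀ x ∈ stateInterval M N, 0 < a x)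
    (ha_meas : AEMeasurable a (volume.restrict (stateInterval M N)))
    {x : ℝ} (hx : x ∈ stateInterval M N) : speedMeasure M N a b o (Ioi x) ≠ 0 := by
  obtain ⟨y, hy, hyx⟩ := exists_mem_stateInterval_gt hx
  exact fun h => speedMeasure_Ioo_ne_zero hC ha_pos ha_meas hx hy hyx
    (measure_mono_null (fun z hz => hz.1) h)

theorem setLIntegral_scaleMeasure (hC : ContinuousOn (potential a b o) (stateInterval M N))
    {h : ℝ → ℝ} (hh : AEMeasurable h (volume.restrict (stateInterval M N))) (h0 : ∀ x, 0 ≤ h x)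
    {s : Set ℝ} (hs : MeasurableSet s) :
    ∫⁻ x in s, ENNReal.ofReal (h x) ∂scaleMeasure M N a b o =
      ∫⁻ x in s ∩ stateInterval M N,
        ENNReal.ofReal (h x * Real.exp (-potential a b o x)) := by
  rw [scaleMeasure, restrict_withDensity hs, lintegral_withDensity_eq_lintegral_mul₀
    (aemeasurable_exp_neg_potential hC).ennreal_ofReal.restrict hh.ennreal_ofReal.restrict,
    Measure.restrict_restrict hs]
  refine lintegral_congr fun x => ?_
  rw [Pi.mul_apply, mul_comm, ENNReal.ofReal_mul (h0 x)]

theorem intervalIntegrable_exp_neg_potential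
    (hC : ContinuousOn (potential a b o) (stateInterval M N))
    {x y : ℝ} (hx : x ∈ stateInterval M N) (hy : y ∈ stateInterval M N) (hxy : x ≤ y) :
    IntervalIntegrable (fun z => Real.exp (-potential a b o z)) volume x y :=
  ContinuousOn.intervalIntegrable_of_Icc hxy
    (hC.mono ((ordConnected_stateInterval M N).out hx hy)).neg.rexp

theorem integral_exp_neg_potential_pos
    (hC : ContinuousOn (potential a b o) (stateInterval M N))
    {x y : ℝ} (hx : x ∈ stateInterval M N) (hy : y ∈ stateInterval M N) (hxy : x < y) :
    0 < ∫ z in x..y, Real.exp (-potential a b o z) :=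
  intervalIntegral.intervalIntegral_pos_of_pos_on
    (intervalIntegrable_exp_neg_potential hC hx hy hxy.le) (fun _ _ => Real.exp_pos _) hxy

theorem scaleMeasure_Ioc (hC : ContinuousOn (potential a b o) (stateInterval M N))
    {x y : ℝ} (hx : x ∈ stateInterval M N) (hy : y ∈ stateInterval M N) (hxy : x ≤ y) :
    scaleMeasure M N a b o (Ioc x y) =
      ENNReal.ofReal (∫ z in x..y, Real.exp (-potential a b o z)) := by
  have hsub : Icc x y ⊆ stateInterval M N := (ordConnected_stateInterval M N).out hx hy
  rw [scaleMeasure, withDensity_apply _ measurableSet_Ioc,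
    Measure.restrict_restrict measurableSet_Ioc,
    inter_eq_left.2 (Ioc_subset_Icc_self.trans hsub), intervalIntegral.integral_of_le hxy,
    ofReal_integral_eq_lintegral_ofReal
      (intervalIntegrable_exp_neg_potential hC hx hy hxy).1
      (Filter.Eventually.of_forall fun _ => (Real.exp_pos _).le)]

/-! ### Lower bound -/

theorem aemeasurable_abs_deriv_mul_exp (hC : ContinuousOn (potential a b o) (stateInterval M N))
    (f : ℝ → ℝ) : AEMeasurable (fun t => |deriv f t| * Real.exp (potential a b o t))
      (volume.restrict (stateInterval M N)) :=
  (measurable_deriv f).norm.aemeasurable.mul (aemeasurable_exp_potential hC)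

theorem aemeasurable_scaleMeasure {h : ℝ → ℝ≥0∞}
    (hh : AEMeasurable h (volume.restrict (stateInterval M N))) :
    AEMeasurable h (scaleMeasure M N a b o) :=
  hh.mono_ac (withDensity_absolutelyContinuous _ _)

/-- The function `|f'| e^C` is the density of `|f'| dx` with respect to `ν`. It serves as `g` in
Hardy's inequality, since its square has `ν`-integral `D(f)`. -/
theorem ofReal_abs_sub_le (hC : ContinuousOn (potential a b o) (stateInterval M N))
    {f : ℝ → ℝ} (hf : IsAC M N f) {p q : ℝ} (hp : p ∈ stateInterval M N)
    (hq : q ∈ stateInterval M N) (hpq : p ≤ q) :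
    ENNReal.ofReal |f q - f p| ≤
      ∫⁻ t in Ioc p q, ENNReal.ofReal (|deriv f t| * Real.exp (potential a b o t))
        ∂scaleMeasure M N a b o := by
  have hsub : Ioc p q ⊆ stateInterval M N :=
    Ioc_subset_Icc_self.trans ((ordConnected_stateInterval M N).out hp hq)
  rw [setLIntegral_scaleMeasure hC (aemeasurable_abs_deriv_mul_exp hC f) (fun x => by positivity)
    measurableSet_Ioc, inter_eq_left.2 hsub, ← (hf p hp q hq hpq).integral_deriv_eq_sub,
    intervalIntegral.integral_of_le hpq, ← Real.enorm_eq_ofReal_abs]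
  refine (enorm_integral_le_lintegral_enorm _).trans_eq (lintegral_congr fun t => ?_)
  rw [mul_assoc, ← Real.exp_add, add_neg_cancel, Real.exp_zero, mul_one, Real.enorm_eq_ofReal_abs]

theorem lintegral_sq_scaleMeasure (hC : ContinuousOn (potential a b o) (stateInterval M N))
    (f : ℝ → ℝ) :
    ∫⁻ t, ENNReal.ofReal (|deriv f t| * Real.exp (potential a b o t)) ^ 2
      ∂scaleMeasure M N a b o = energy M N a b o f := by
  have h := setLIntegral_scaleMeasure hC ((aemeasurable_abs_deriv_mul_exp hC f).pow_const 2)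
    (fun x => sq_nonneg _) MeasurableSet.univ
  rw [setLIntegral_univ, univ_inter] at h
  refine Eq.trans (lintegral_congr fun t => ?_) (h.trans (lintegral_congr fun t => ?_))
  · rw [ENNReal.ofReal_pow (by positivity)]
  · rw [mul_pow, sq_abs, mul_assoc, sq (Real.exp _), mul_assoc, ← Real.exp_add, add_neg_cancel,
      Real.exp_zero, mul_one]

theorem ae_mem_stateInterval_scaleMeasure :
    ∀ᵐ t ∂scaleMeasure M N a b o, t ∈ stateInterval M N :=
  scaleMeasure_compl M N a b o

theorem ae_mem_stateInterval_speedMeasure :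
    ∀ᵐ t ∂speedMeasure M N a b o, t ∈ stateInterval M N :=
  speedMeasure_compl M N a b o

theorem lintegral_Ioi_sq_sub_le (hC : ContinuousOn (potential a b o) (stateInterval M N))
    [IsFiniteMeasure (speedMeasure M N a b o)]
    {f : ℝ → ℝ} (hf : IsAC M N f) {θ : ℝ} (hθ : θ ∈ stateInterval M N) {κ : ℝ≥0∞} (hκ0 : κ ≠ 0)
    (hκ : ∀ y, scaleMeasure M N a b o (Ioo θ y) * speedMeasure M N a b o (Ioi y) ≤ κ) :
    ∫⁻ y in Ioi θ, ENNReal.ofReal ((f y - f θ) ^ 2) ∂speedMeasure M N a b o ≤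
      4 * κ * ∫⁻ t in Ioi θ, ENNReal.ofReal (|deriv f t| * Real.exp (potential a b o t)) ^ 2
        ∂scaleMeasure M N a b o := by
  set μ := speedMeasure M N a b o
  set ν := scaleMeasure M N a b o
  have hν : ∀ t, ν.restrict (Ioi θ) (Iic t) = ν (Ioc θ t) := fun t => by
    rw [Measure.restrict_apply measurableSet_Iic, inter_comm, Ioi_inter_Iic]
  refine le_trans ?_ (lintegral_sq_setLIntegral_Iic_le (μ.restrict (Ioi θ)) (ν.restrict (Ioi θ))
    hκ0 (fun y => ?_) ?_ (aemeasurable_scaleMeasure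
      (aemeasurable_abs_deriv_mul_exp hC f).ennreal_ofReal).restrict)
  · refine lintegral_mono_ae ?_
    filter_upwards [ae_restrict_of_ae ae_mem_stateInterval_speedMeasure,
      ae_restrict_mem measurableSet_Ioi] with y hy hθy
    rw [← sq_abs, ENNReal.ofReal_pow (abs_nonneg _), Measure.restrict_restrict measurableSet_Iic,
      inter_comm, Ioi_inter_Iic]
    exact pow_le_pow_left' (ofReal_abs_sub_le hC hf hθ hy (le_of_lt hθy)) 2
  · rw [hν, ← measure_congr (Ioo_ae_eq_Ioc (μ := ν))]
    refine le_trans (mul_le_mul' le_rfl ?_) (hκ y)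
    rw [measure_congr (Ioi_ae_eq_Ici (μ := μ))]
    exact Measure.restrict_apply_le _ _
  · filter_upwards [ae_restrict_of_ae ae_mem_stateInterval_scaleMeasure,
      ae_restrict_mem measurableSet_Ioi] with t ht hθt
    rw [hν, scaleMeasure_Ioc hC hθ ht (le_of_lt hθt)]
    exact ENNReal.ofReal_ne_top

theorem lintegral_Iio_sq_sub_le (hC : ContinuousOn (potential a b o) (stateInterval M N))
    [IsFiniteMeasure (speedMeasure M N a b o)]
    {f : ℝ → ℝ} (hf : IsAC M N f) {θ : ℝ} (hθ : θ ∈ stateInterval M N) {κ : ℝ≥0∞} (hκ0 : κ ≠ 0)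
    (hκ : ∀ x, scaleMeasure M N a b o (Ioo x θ) * speedMeasure M N a b o (Iio x) ≤ κ) :
    ∫⁻ x in Iio θ, ENNReal.ofReal ((f x - f θ) ^ 2) ∂speedMeasure M N a b o ≤
      4 * κ * ∫⁻ t in Iio θ, ENNReal.ofReal (|deriv f t| * Real.exp (potential a b o t)) ^ 2
        ∂scaleMeasure M N a b o := by
  set μ := speedMeasure M N a b o
  set ν := scaleMeasure M N a b o
  have hν : ∀ t, ν.restrict (Iio θ) (Ici t) = ν (Ioc t θ) := fun t => by
    rw [Measure.restrict_apply measurableSet_Ici, Ici_inter_Iio, measure_congr Ico_ae_eq_Ioc]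
  refine le_trans ?_ (lintegral_sq_setLIntegral_Ici_le (μ.restrict (Iio θ)) (ν.restrict (Iio θ))
    hκ0 (fun y => ?_) ?_ (aemeasurable_scaleMeasure
      (aemeasurable_abs_deriv_mul_exp hC f).ennreal_ofReal).restrict)
  · refine lintegral_mono_ae ?_
    filter_upwards [ae_restrict_of_ae ae_mem_stateInterval_speedMeasure,
      ae_restrict_mem measurableSet_Iio] with y hy hθy
    rw [← sq_abs, ENNReal.ofReal_pow (abs_nonneg _), Measure.restrict_restrict measurableSet_Ici,
      Ici_inter_Iio, abs_sub_comm, setLIntegral_congr (Ico_ae_eq_Ioc (μ := ν))]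
    exact pow_le_pow_left' (ofReal_abs_sub_le hC hf hy hθ (le_of_lt hθy)) 2
  · rw [hν, ← measure_congr (Ioo_ae_eq_Ioc (μ := ν))]
    refine le_trans (mul_le_mul' le_rfl ?_) (hκ y)
    rw [measure_congr (Iio_ae_eq_Iic (μ := μ))]
    exact Measure.restrict_apply_le _ _
  · filter_upwards [ae_restrict_of_ae ae_mem_stateInterval_scaleMeasure,
      ae_restrict_mem measurableSet_Iio] with t ht hθt
    rw [hν, scaleMeasure_Ioc hC ht hθ (le_of_lt hθt)]
    exact ENNReal.ofReal_ne_top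

theorem lintegral_sq_sub_le_energy (hC : ContinuousOn (potential a b o) (stateInterval M N))
    [IsFiniteMeasure (speedMeasure M N a b o)]
    {f : ℝ → ℝ} (hf : IsAC M N f) {θ : ℝ} (hθ : θ ∈ stateInterval M N) {κ : ℝ≥0∞} (hκ0 : κ ≠ 0)
    (hκr : ∀ y, scaleMeasure M N a b o (Ioo θ y) * speedMeasure M N a b o (Ioi y) ≤ κ)
    (hκl : ∀ x, scaleMeasure M N a b o (Ioo x θ) * speedMeasure M N a b o (Iio x) ≤ κ) :
    ∫⁻ x, ENNReal.ofReal ((f x - f θ) ^ 2) ∂speedMeasure M N a b o ≤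
      4 * κ * energy M N a b o f := by
  rw [← setLIntegral_univ, ← Iio_union_Ici (a := θ), ← lintegral_sq_scaleMeasure hC f]
  refine (lintegral_union_le _ _ _).trans ?_
  rw [← setLIntegral_congr (Ioi_ae_eq_Ici (μ := speedMeasure M N a b o))]
  refine (add_le_add (lintegral_Iio_sq_sub_le hC hf hθ hκ0 hκl)
    (lintegral_Ioi_sq_sub_le hC hf hθ hκ0 hκr)).trans ?_
  rw [← mul_add]
  refine mul_le_mul' le_rfl ?_
  rw [setLIntegral_congr (Ioi_ae_eq_Ici (μ := scaleMeasure M N a b o)), ← compl_Iio,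
    lintegral_add_compl _ measurableSet_Iio]

theorem inv_four_mul_kappaNN_le_lambdaNN
    (hC : ContinuousOn (potential a b o) (stateInterval M N)) (ho : o ∈ stateInterval M N)
    (ha_pos : ∀ x ∈ stateInterval M N, 0 < a x)
    (ha_meas : AEMeasurable a (volume.restrict (stateInterval M N)))
    [IsFiniteMeasure (speedMeasure M N a b o)] :
    (4 * kappaNN M N a b o)⁻¹ ≤ lambdaNN M N a b o := by
  have hIio := fun x hx => speedMeasure_Iio_ne_zero (x := x) hC ha_pos ha_meas hx
  have hIoi := fun x hx => speedMeasure_Ioi_ne_zero (x := x) hC ha_pos ha_meas hx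
  -- For `κ = ∞` the lower bound is 0; otherwise the splitting point is available.
  rcases eq_or_ne (kappaNN M N a b o) ∞ with hκt | hκt
  · simp [hκt]
  have hIoo : ∀ x ∈ stateInterval M N, ∀ y ∈ stateInterval M N, x < y →
      scaleMeasure M N a b o (Ioo x y) ≠ 0 ∧ scaleMeasure M N a b o (Ioo x y) ≠ ∞ := by
    intro x hx y hy hxy
    rw [measure_congr Ioo_ae_eq_Ioc, scaleMeasure_Ioc hC hx hy hxy.le]
    exact ⟨(ENNReal.ofReal_pos.2 (integral_exp_neg_potential_pos hC hx hy hxy)).ne',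
      ENNReal.ofReal_ne_top⟩
  have hinf : ∀ x ∈ stateInterval M N, ∀ y ∈ stateInterval M N, x < y →
      (kappaNN M N a b o)⁻¹ ≤ ((speedMeasure M N a b o (Iio x))⁻¹ +
        (speedMeasure M N a b o (Ioi y))⁻¹) * (scaleMeasure M N a b o (Ioo x y))⁻¹ := by
    intro x hx y hy hxy
    rw [kappaNN, inv_inv]
    refine (iInf₂_le_of_le x y (iInf₂_le_of_le hx hy (iInf_le _ hxy))).trans_eq ?_
    rw [speedMeasure_lower, speedMeasure_upper]
  have hκ0 : kappaNN M N a b o ≠ 0 := by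
    obtain ⟨y, hy, hoy⟩ := exists_mem_stateInterval_gt ho
    intro h
    have h1 := hinf o ho y hy hoy
    rw [h, ENNReal.inv_zero, top_le_iff] at h1
    refine ENNReal.mul_ne_top (ENNReal.add_ne_top.2 ⟨?_, ?_⟩) ?_ h1
    · exact ENNReal.inv_ne_top.2 (hIio o ho)
    · exact ENNReal.inv_ne_top.2 (hIoi y hy)
    · exact ENNReal.inv_ne_top.2 (hIoo o ho y hy hoy).1
  obtain ⟨θ, hθ, hr, hl⟩ := exists_splitting_point (isOpen_stateInterval M N)
    (ordConnected_stateInterval M N) ⟨o, ho⟩ (speedMeasure_compl M N a b o)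
    (scaleMeasure_compl M N a b o) hκ0 hκt hIio hIoi fun x hx y hy hxy => by
      have h := hinf x hx y hy hxy
      obtain ⟨h0, ht⟩ := hIoo x hx y hy hxy
      rw [← div_eq_mul_inv, ENNReal.le_div_iff_mul_le (Or.inl h0) (Or.inl ht), mul_comm,
        ← div_eq_mul_inv] at h
      rw [mul_comm]
      exact (ENNReal.div_le_iff hκ0 hκt).1 h
  refine le_sInf ?_
  rintro d ⟨f, hf, hfi, hf0, hf1, rfl⟩
  have h := (one_le_lintegral_ofReal_sq_sub hfi hf0 hf1 (f θ)).trans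
    (lintegral_sq_sub_le_energy hC hf hθ hκ0 hr hl)
  rw [mul_comm] at h
  rw [← one_div]
  exact ENNReal.div_le_of_le_mul h

/-! ### Upper bound by test functions -/

/-- The primitive of `e^{-C}` between `x` and `y`, constant to the left of `x` and to the right
of `y`. -/
noncomputable def testFunction (a b : ℝ → ℝ) (o x y z : ℝ) : ℝ :=
  ∫ t in x..z, (Ioc x y).indicator (fun t => Real.exp (-potential a b o t)) t

theorem integrable_indicator_exp_neg_potential
    (hC : ContinuousOn (potential a b o) (stateInterval M N))
    {x y : ℝ} (hx : x ∈ stateInterval M N) (hy : y ∈ stateInterval M N) (hxy : x ≤ y) :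
    Integrable ((Ioc x y).indicator fun t => Real.exp (-potential a b o t)) :=
  (integrable_indicator_iff measurableSet_Ioc).2
    (intervalIntegrable_exp_neg_potential hC hx hy hxy).1

theorem testFunction_of_le {x y z : ℝ} (hz : z ≤ x) : testFunction a b o x y z = 0 := by
  rw [testFunction, intervalIntegral.integral_symm, intervalIntegral.integral_of_le hz, neg_eq_zero]
  exact setIntegral_eq_zero_of_forall_eq_zero fun t ht =>
    indicator_of_notMem (fun h => not_lt_of_ge ht.2 h.1) _

theorem testFunction_of_ge {x y z : ℝ} (hxy : x ≤ y) (hz : y ≤ z) :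
    testFunction a b o x y z = ∫ t in x..y, Real.exp (-potential a b o t) := by
  rw [testFunction, intervalIntegral.integral_of_le (hxy.trans hz),
    intervalIntegral.integral_of_le hxy, setIntegral_indicator measurableSet_Ioc,
    inter_eq_right.2 (Ioc_subset_Ioc_right hz)]

theorem absolutelyContinuousOnInterval_testFunction
    (hC : ContinuousOn (potential a b o) (stateInterval M N))
    {x y : ℝ} (hx : x ∈ stateInterval M N) (hy : y ∈ stateInterval M N) (hxy : x ≤ y)
    (p q : ℝ) : AbsolutelyContinuousOnInterval (testFunction a b o x y) p q := by
  have h := (integrable_indicator_exp_neg_potential hC hx hy hxy).intervalIntegrable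
    (a := min (min p q) x) (b := max (max p q) x)
  have hle : min (min p q) x ≤ max (max p q) x := (min_le_right _ _).trans (le_max_right _ _)
  refine (h.absolutelyContinuousOnInterval_intervalIntegral (c := x) ?_).mono ?_
  · rw [uIcc_of_le hle]; exact ⟨min_le_right _ _, le_max_right _ _⟩
  · rw [uIcc_of_le hle]; exact Icc_subset_Icc (min_le_left _ _) (le_max_left _ _)

theorem continuous_testFunction
    (hC : ContinuousOn (potential a b o) (stateInterval M N))
    {x y : ℝ} (hx : x ∈ stateInterval M N) (hy : y ∈ stateInterval M N) (hxy : x ≤ y) :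
    Continuous (testFunction a b o x y) :=
  intervalIntegral.continuous_primitive
    (fun _ _ => (integrable_indicator_exp_neg_potential hC hx hy hxy).intervalIntegrable) x

theorem abs_testFunction_le
    (hC : ContinuousOn (potential a b o) (stateInterval M N))
    {x y : ℝ} (hx : x ∈ stateInterval M N) (hy : y ∈ stateInterval M N) (hxy : x ≤ y) (z : ℝ) :
    |testFunction a b o x y z| ≤
      ∫ t, (Ioc x y).indicator (fun t => Real.exp (-potential a b o t)) t := by
  have hnn : ∀ t, 0 ≤ (Ioc x y).indicator (fun t => Real.exp (-potential a b o t)) t :=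
    fun t => indicator_nonneg (fun _ _ => (Real.exp_pos _).le) t
  rw [← Real.norm_eq_abs, testFunction]
  refine intervalIntegral.norm_integral_le_integral_norm_uIoc.trans ?_
  simp_rw [Real.norm_of_nonneg (hnn _)]
  exact setIntegral_le_integral (integrable_indicator_exp_neg_potential hC hx hy hxy)
    (Filter.Eventually.of_forall hnn)

theorem ae_deriv_testFunction
    (hC : ContinuousOn (potential a b o) (stateInterval M N))
    {x y : ℝ} (hx : x ∈ stateInterval M N) (hy : y ∈ stateInterval M N) (hxy : x ≤ y) :
    ∀ᵐ z, deriv (testFunction a b o x y) z =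
      (Ioc x y).indicator (fun t => Real.exp (-potential a b o t)) z := by
  have h := (integrable_indicator_exp_neg_potential hC hx hy hxy)
  filter_upwards [LocallyIntegrable.ae_hasDerivAt_integral h.locallyIntegrable] with z hz
  exact (hz x).deriv

/-- On `Ioc x y` the squared derivative is `e^{-2C} / s²`, so multiplying by `e^C` leaves the
density of `ν` over `s²`. -/
theorem energy_sub_const_div (hC : ContinuousOn (potential a b o) (stateInterval M N))
    {x y : ℝ} (hx : x ∈ stateInterval M N) (hy : y ∈ stateInterval M N) (hxy : x ≤ y) (m s : ℝ) :
    energy M N a b o (fun z => (testFunction a b o x y z - m) / s) =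
      ENNReal.ofReal ((∫ t in x..y, Real.exp (-potential a b o t)) / s ^ 2) := by
  have hsub : Ioc x y ⊆ stateInterval M N :=
    Ioc_subset_Icc_self.trans ((ordConnected_stateInterval M N).out hx hy)
  have h1 : energy M N a b o (fun z => (testFunction a b o x y z - m) / s) =
      ∫⁻ z in stateInterval M N, (Ioc x y).indicator
        (fun t => ENNReal.ofReal (Real.exp (-potential a b o t) / s ^ 2)) z := by
    refine lintegral_congr_ae (ae_restrict_of_ae ?_)
    filter_upwards [ae_deriv_testFunction hC hx hy hxy] with z hz
    rw [deriv_div_const, deriv_sub_const, hz]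
    by_cases hzm : z ∈ Ioc x y
    · rw [indicator_of_mem hzm, indicator_of_mem hzm]
      congr 1
      rw [div_pow, sq (Real.exp _), div_mul_eq_mul_div, mul_assoc, ← Real.exp_add, neg_add_cancel,
        Real.exp_zero, mul_one]
    · simp [indicator_of_notMem hzm]
  rw [h1, lintegral_indicator measurableSet_Ioc, Measure.restrict_restrict measurableSet_Ioc,
    inter_eq_left.2 hsub, ← ofReal_integral_eq_lintegral_ofReal
      ((intervalIntegrable_exp_neg_potential hC hx hy hxy).1.div_const _)
      (Filter.Eventually.of_forall fun _ => by positivity), integral_div,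
    intervalIntegral.integral_of_le hxy]

theorem isAC_sub_const_div (hC : ContinuousOn (potential a b o) (stateInterval M N))
    {x y : ℝ} (hx : x ∈ stateInterval M N) (hy : y ∈ stateInterval M N) (hxy : x ≤ y) (m s : ℝ) :
    IsAC M N (fun z => (testFunction a b o x y z - m) / s) := by
  intro p _ q _ _
  have h := ((absolutelyContinuousOnInterval_testFunction hC hx hy hxy p q).fun_sub
    (contDiffOn_const (c := m)).absolutelyContinuousOnInterval).const_mul s⁻¹
  simpa only [div_eq_inv_mul] using h

end NeumannGap

/-- The contribution of the middle piece `[x, y]` is nonnegative and is dropped. -/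
theorem sq_mul_measure_add_le_integral {μ : Measure ℝ} [IsFiniteMeasure μ] {g : ℝ → ℝ}
    (hg : Integrable (fun z => g z ^ 2) μ) {x y c d : ℝ} (hxy : x < y)
    (hc : ∀ z < x, g z = c) (hd : ∀ z > y, g z = d) :
    c ^ 2 * μ.real (Iio x) + d ^ 2 * μ.real (Ioi y) ≤ ∫ z, g z ^ 2 ∂μ := by
  have hdisj : Disjoint (Iio x) (Ioi y) :=
    disjoint_left.2 fun z hz hz' => lt_asymm hxy (lt_trans hz' hz)
  have h1 : ∫ z in Iio x, g z ^ 2 ∂μ = c ^ 2 * μ.real (Iio x) := by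
    rw [setIntegral_congr_fun (g := fun _ => c ^ 2) measurableSet_Iio
      (fun z hz => by simp only [hc z hz]), setIntegral_const, smul_eq_mul, mul_comm]
  have h2 : ∫ z in Ioi y, g z ^ 2 ∂μ = d ^ 2 * μ.real (Ioi y) := by
    rw [setIntegral_congr_fun (g := fun _ => d ^ 2) measurableSet_Ioi
      (fun z hz => by simp only [hd z hz]), setIntegral_const, smul_eq_mul, mul_comm]
  rw [← h1, ← h2, ← setIntegral_union hdisj measurableSet_Ioi hg.integrableOn hg.integrableOn]
  exact setIntegral_le_integral hg (Filter.Eventually.of_forall fun _ => sq_nonneg _)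

namespace NeumannGap

variable {M N : EReal} {a b : ℝ → ℝ} {o : ℝ}

theorem lambdaNN_le_inv_kappaNN
    (hC : ContinuousOn (potential a b o) (stateInterval M N))
    (ha_pos : ∀ x ∈ stateInterval M N, 0 < a x)
    (ha_meas : AEMeasurable a (volume.restrict (stateInterval M N)))
    [IsFiniteMeasure (speedMeasure M N a b o)] :
    lambdaNN M N a b o ≤ (kappaNN M N a b o)⁻¹ := by
  rw [kappaNN, inv_inv]
  refine le_iInf₂ fun x y => le_iInf₂ fun hx hy => le_iInf fun hxy => ?_
  rw [speedMeasure_lower, speedMeasure_upper, measure_congr Ioo_ae_eq_Ioc,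
    scaleMeasure_Ioc hC hx hy hxy.le]
  set μ := speedMeasure M N a b o
  set v := ∫ t in x..y, Real.exp (-potential a b o t) with hv
  set g := testFunction a b o x y with hg
  have hvpos : 0 < v := integral_exp_neg_potential_pos hC hx hy hxy
  have hp : 0 < μ.real (Iio x) :=
    ENNReal.toReal_pos (speedMeasure_Iio_ne_zero hC ha_pos ha_meas hx) (measure_ne_top _ _)
  have hq : 0 < μ.real (Ioi y) :=
    ENNReal.toReal_pos (speedMeasure_Ioi_ne_zero hC ha_pos ha_meas hy) (measure_ne_top _ _)
  have hgc : Continuous g := continuous_testFunction hC hx hy hxy.le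
  have hgL : ∀ m : ℝ, MemLp (fun z => g z - m) 2 μ := fun m =>
    (MemLp.of_bound hgc.aestronglyMeasurable _
      (Filter.Eventually.of_forall (abs_testFunction_le hC hx hy hxy.le))).sub (memLp_const m)
  have hgi : Integrable g μ := by simpa using (hgL 0).integrable (by norm_num)
  have hμpos : 0 < μ.real univ := hp.trans_le (measureReal_mono (subset_univ _))
  set m := (∫ z, g z ∂μ) / μ.real univ with hm
  have hmean : ∫ z, (g z - m) ∂μ = 0 := by
    rw [integral_sub hgi (integrable_const _), integral_const, smul_eq_mul, hm,
      mul_div_cancel₀ _ hμpos.ne', sub_self]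
  set W := ∫ z, (g z - m) ^ 2 ∂μ with hW
  have hWge : (0 - m) ^ 2 * μ.real (Iio x) + (v - m) ^ 2 * μ.real (Ioi y) ≤ W :=
    sq_mul_measure_add_le_integral (hgL m).integrable_sq hxy
      (fun z hz => by rw [hg, testFunction_of_le (le_of_lt hz)])
      (fun z hz => by rw [hg, testFunction_of_ge hxy.le (le_of_lt hz)])
  set p := μ.real (Iio x) with hpdef
  set q := μ.real (Ioi y) with hqdef
  -- This rests on `(m² p + (v - m)² q)(p + q) = v² p q + (m (p + q) - v q)²`, so the value of the
  -- mean `m` plays no role.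
  have hW2 : v ^ 2 * (p * q) ≤ W * (p + q) := by
    nlinarith [mul_le_mul_of_nonneg_right hWge (add_pos hp hq).le, sq_nonneg (m * (p + q) - v * q)]
  have hWpos : 0 < W := by
    by_contra h
    have h1 : 0 < v ^ 2 * (p * q) := by positivity
    nlinarith [mul_nonneg (sub_nonneg.2 (not_lt.1 h)) (add_pos hp hq).le]
  have hs : √W ^ 2 = W := Real.sq_sqrt hWpos.le
  have hle : lambdaNN M N a b o ≤ energy M N a b o (fun z => (g z - m) / √W) := by
    refine sInf_le ⟨_, isAC_sub_const_div hC hx hy hxy.le m _,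
      ((hgL m).integrable (by norm_num)).div_const _, ?_, ?_, rfl⟩
    · rw [integral_div, hmean, zero_div]
    · have h2 : eLpNorm (fun z => (g z - m) / √W) 2 μ ^ 2 = 1 := by
        rw [← lintegral_ofReal_sq_eq_eLpNorm_two_sq]
        simp_rw [div_pow, hs]
        rw [← ofReal_integral_eq_lintegral_ofReal ((hgL m).integrable_sq.div_const _)
          (Filter.Eventually.of_forall fun _ => by positivity), integral_div, ← hW,
          div_self hWpos.ne', ENNReal.ofReal_one]
      exact (ENNReal.pow_right_strictMono two_ne_zero).injective (h2.trans (one_pow 2).symm)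
  refine hle.trans ?_
  rw [energy_sub_const_div hC hx hy hxy.le, hs, ← hv]
  have e1 : μ (Iio x) = ENNReal.ofReal p := (ENNReal.ofReal_toReal (measure_ne_top _ _)).symm
  have e2 : μ (Ioi y) = ENNReal.ofReal q := (ENNReal.ofReal_toReal (measure_ne_top _ _)).symm
  rw [e1, e2, ← ENNReal.ofReal_inv_of_pos hp, ← ENNReal.ofReal_inv_of_pos hq,
    ← ENNReal.ofReal_inv_of_pos hvpos, ← ENNReal.ofReal_add (by positivity) (by positivity),
    ← ENNReal.ofReal_mul (by positivity)]
  refine ENNReal.ofReal_le_ofReal ?_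
  have e3 : (p⁻¹ + q⁻¹) * v⁻¹ = (p + q) / (p * q * v) := by field_simp; ring
  rw [e3, div_le_div_iff₀ hWpos (by positivity)]
  nlinarith

end NeumannGap

theorem mainTheorem4 (M N : EReal) (a b : ℝ → ℝ) (o : ℝ)
    (ho : o ∈ NeumannGap.stateInterval M N)
    (ha_pos : ∀ x ∈ NeumannGap.stateInterval M N, 0 < a x)
    (ha_meas : AEMeasurable a (volume.restrict (NeumannGap.stateInterval M N)))
    (hba : LocallyIntegrableOn (fun x => b x / a x) (NeumannGap.stateInterval M N) volume)
    (hμ : NeumannGap.speedMeasure M N a b o (NeumannGap.stateInterval M N) < ∞) :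
    (4 * NeumannGap.kappaNN M N a b o)⁻¹ ≤ NeumannGap.lambdaNN M N a b o ∧
      NeumannGap.lambdaNN M N a b o ≤ (NeumannGap.kappaNN M N a b o)⁻¹ := by
  have hC := NeumannGap.continuousOn_potential ho hba
  have := NeumannGap.isFiniteMeasure_speedMeasure hμ
  exact ⟨NeumannGap.inv_four_mul_kappaNN_le_lambdaNN hC ho ha_pos ha_meas,
    NeumannGap.lambdaNN_le_inv_kappaNN hC ha_pos ha_meas⟩
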